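/- There is an absolute constant $\delta>0$ such that the following holds for all $a,b,c\in\mathbb C$ with $0<|a|,|b|,|c|<\delta$, $|c|<\delta|a|$, $|b|<\delta|a|$ and $|ab|<\delta|c|$. Let $F:\mathbb C^2\to\mathbb C^2$, $F(z,w)=(az+z^2,\;w^2+cw+bz)$, and let $\Omega$ be the immediate basin of attraction of the fixed point $(0,0)$, i.e. the connected component containing $(0,0)$ of $\{x\in\mathbb C^2: F^n(x)\to(0,0)\}$. Then the backward orbit $\bigcup_{k\ge 0}F^{-k}(0,0)$ is contained in $\Omega$, and for every constant $C>0$ there is a point $(z_0,0)\in\Omega$ such that $d_\Omega\big((z_0,0),(\tilde z,\tilde w)\big)\ge C$ for every $(\tilde z,\tilde w)\in\bigcup_{k\ge0}F^{-k}(0,0)$. Here $d_\Omega$ is the Kobayashi distance: with $\triangle$ the unit disc and $K_\Omega(p,\xi)=\inf\{\lambda>0:\exists f:\triangle\to\Omega \text{ holomorphic},\ f(0)=p,\ \lambda f'(0)=\xi\}$, $d_\Omega(p,q)$ is the infimum of $\int_0^1K_\Omega(\gamma(t),\gamma'(t))\,dt$ over all piecewise smooth curves $\gamma:[0,1]\to\Omega$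 from $p$ to $q$. -/

import Mathlib

open Set Filter Topology
open scoped ENNReal ContDiff

/-- The Kobayashi (infinitesimal) metric of `Ω ⊆ ℂ²` at `p` in the direction `ξ`: the infimum of
the `r > 0` for which some holomorphic `f` from the unit disc to `Ω` has `f 0 = p` and
`r • f' 0 = ξ`. -/
noncomputable def kobayashiMetric (Ω : Set (ℂ × ℂ)) (p ξ : ℂ × ℂ) : ℝ≥0∞ :=
  ⨅ (r : ℝ) (_ : 0 < r) (_ : ∃ f : ℂ → ℂ × ℂ,
      DifferentiableOn ℂ f (Metric.ball 0 1) ∧ MapsTo f (Metric.ball 0 1) Ω ∧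
      f 0 = p ∧ r • deriv f 0 = ξ), ENNReal.ofReal r

/-- `γ` restricted to `[0, 1]` is a piecewise smooth curve: it is continuous, and smooth on each
closed interval of a finite partition of `[0, 1]`. -/
def IsPiecewiseSmooth (γ : ℝ → ℂ × ℂ) : Prop :=
  ContinuousOn γ (Icc 0 1) ∧
  ∃ (n : ℕ) (t : Fin (n + 1) → ℝ), StrictMono t ∧ t 0 = 0 ∧ t (Fin.last n) = 1 ∧
    ∀ i : Fin n, ContDiffOn ℝ ∞ γ (Icc (t i.castSucc) (t i.succ))

/-- The Kobayashi length of a curve parametrized by `[0, 1]`. -/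
noncomputable def kobayashiLength (Ω : Set (ℂ × ℂ)) (γ : ℝ → ℂ × ℂ) : ℝ≥0∞ :=
  ∫⁻ t in Icc (0 : ℝ) 1, kobayashiMetric Ω (γ t) (deriv γ t)

/-- The Kobayashi distance: the infimum of the Kobayashi lengths of the piecewise smooth curves
in `Ω` from `p` to `q` (it is `⊤` when there is no such curve). -/
noncomputable def kobayashiDist (Ω : Set (ℂ × ℂ)) (p q : ℂ × ℂ) : ℝ≥0∞ :=
  ⨅ (γ : ℝ → ℂ × ℂ) (_ : IsPiecewiseSmooth γ ∧ MapsTo γ (Icc 0 1) Ω ∧ γ 0 = p ∧ γ 1 = q),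
    kobayashiLength Ω γ

/-- The basin of attraction of `p` under `F`. -/
def basin (F : ℂ × ℂ → ℂ × ℂ) (p : ℂ × ℂ) : Set (ℂ × ℂ) :=
  {x | Tendsto (fun n : ℕ => F^[n] x) atTop (𝓝 p)}

/-- The immediate basin: the connected component of the basin of attraction containing `p`. -/
def immediateBasin (F : ℂ × ℂ → ℂ × ℂ) (p : ℂ × ℂ) : Set (ℂ × ℂ) :=
  connectedComponentIn (basin F p) p

/-- The backward orbit `⋃ k ≥ 0, F⁻ᵏ(p)`. -/
def backwardOrbit (F : ℂ × ℂ → ℂ × ℂ) (p : ℂ × ℂ) : Set (ℂ × ℂ) :=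
  ⋃ k : ℕ, F^[k] ⁻¹' {p}

/-- The polynomial skew product `F(z, w) = (a z + z², w² + c w + b z)`. -/
def skewMap (a b c : ℂ) (x : ℂ × ℂ) : ℂ × ℂ :=
  (a * x.1 + x.1 ^ 2, x.2 ^ 2 + c * x.2 + b * x.1)

/-! Write `P(z) = a z + z²` for the base map. A holomorphic `φ` from the basin to the punctured disc
decreases hyperbolic length, so `|log(-log|φ q|) - log(-log|φ p|)| / 2` bounds the Kobayashi
distance from below (`ofReal_le_kobayashiDist`). Two such functions suffice.

Let `β` be a boundary point of the basin of `P`, and `z₀` a point of that basin extremely close to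
`β`. Then `(z - β) / 4` separates `(z₀, 0)` from every `q` whose first coordinate is not close to
`β` (`ofReal_le_kobayashiDist_of_fst`).

If the first coordinate of `q` is close to `β`, its base orbit stays away from `0` for a long time.
Were `w` to become small early in that time, it would contract to size `O(|b|)` and then follow `b
z`. The base orbit can reach `0` only through `-a`, where `w` lands near `-ab`: nonzero and smaller
than `|c|`. On the fibre `z = 0` the map `w(w + c)` never sends such a point to `0`, so `q` would
not be in the backward orbit (`iterate_ne_zero_of_norm_snd_le`). Hence `w` stays large for many
steps, and pulling back the graph `w = 2` along the orbit gives a graph `w = s(z)` that avoids the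
basin and passes exponentially close to `q` (`exists_section_avoiding_basin`). Then `(s(z) - w) / 4`
separates `q` from `(z₀, 0)`.

The immediate basin is the whole basin: the basin is the union of the preimages of a small ball,
which are connected because `F` is open and closed and the fibre over `0` lies in the ball. -/

/-! ### Lower bounds for the Kobayashi metric and distance -/

/-- A holomorphic map of the unit disc into itself that omits `0` satisfies the Schwarz lemma for
the hyperbolic metric of the punctured disc. -/
theorem norm_deriv_le_of_mapsTo_punctured_ball {h : ℂ → ℂ}
    (hd : DifferentiableOn ℂ h (Metric.ball 0 1))
    (h0 : ∀ z ∈ Metric.ball (0 : ℂ) 1, h z ≠ 0) (h1 : ∀ z ∈ Metric.ball (0 : ℂ) 1, ‖h z‖ < 1) :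
    ‖deriv h 0‖ ≤ 2 * ‖h 0‖ * -Real.log ‖h 0‖ := by
  have hmem : (0 : ℂ) ∈ Metric.ball (0 : ℂ) 1 := by simp
  have hdh : DifferentiableOn ℂ (deriv h) (Metric.ball 0 1) := hd.deriv Metric.isOpen_ball
  have hq : DifferentiableOn ℂ (fun z => deriv h z / h z) (Metric.ball 0 1) := hdh.div hd h0
  -- A primitive of `h' / h` with the right value at `0` is a logarithm of `h`; it maps the disc to
  -- the left half-plane.
  obtain ⟨g, hg0, hg⟩ := hq.isExactOn_ball.with_val_at 0 (Complex.log (h 0))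
  have hexp : ∀ z ∈ Metric.ball (0 : ℂ) 1, Complex.exp (g z) = h z := by
    have hder : ∀ z ∈ Metric.ball (0 : ℂ) 1,
        HasDerivAt (fun z => h z * Complex.exp (-g z)) 0 z := by
      intro z hz
      have hh := (hd.differentiableAt (Metric.isOpen_ball.mem_nhds hz)).hasDerivAt
      have h2 : HasDerivAt (fun z => h z * Complex.exp (-g z))
          (deriv h z * Complex.exp (-g z) + h z * (Complex.exp (-g z) * -(deriv h z / h z))) z :=
        hh.mul (hg z hz).neg.cexp
      have h3 : h z * (Complex.exp (-g z) * -(deriv h z / h z)) =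
          -(deriv h z * Complex.exp (-g z)) := by
        have := h0 z hz
        field_simp
      rwa [h3, add_neg_cancel] at h2
    have hconst : ∀ z ∈ Metric.ball (0 : ℂ) 1,
        h z * Complex.exp (-g z) = h 0 * Complex.exp (-g 0) := by
      intro z hz
      refine (convex_ball (0 : ℂ) 1).is_const_of_fderivWithin_eq_zero (𝕜 := ℂ)
        (f := fun z => h z * Complex.exp (-g z))
        (fun z hz => (hder z hz).differentiableAt.differentiableWithinAt) ?_ hz hmem
      intro z hz
      rw [fderivWithin_of_isOpen Metric.isOpen_ball hz]
      ext
      simpa using (hder z hz).deriv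
    intro z hz
    have h2 := hconst z hz
    rw [hg0, Complex.exp_neg, Complex.exp_neg, Complex.exp_log (h0 0 hmem),
      mul_inv_cancel₀ (h0 0 hmem), ← div_eq_mul_inv,
      div_eq_one_iff_eq (Complex.exp_ne_zero _)] at h2
    exact h2.symm
  have hre : ∀ z ∈ Metric.ball (0 : ℂ) 1, (g z).re < 0 := by
    intro z hz
    have h2 := h1 z hz
    rw [← hexp z hz, Complex.norm_exp] at h2
    simpa using h2
  have hre0 : (g 0).re = Real.log ‖h 0‖ := by rw [hg0, Complex.log_re]
  have hden : ∀ z ∈ Metric.ball (0 : ℂ) 1, g z + (starRingEnd ℂ) (g 0) ≠ 0 := by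
    intro z hz h2
    have h3 := congrArg Complex.re h2
    simp at h3
    linarith [hre z hz, hre 0 hmem]
  -- The Cayley transform centred at `g 0` takes the half-plane to the disc, so the Schwarz lemma
  -- applies at `0`.
  have hk : ∀ z ∈ Metric.ball (0 : ℂ) 1,
      HasDerivAt (fun z => (g z - g 0) / (g z + (starRingEnd ℂ) (g 0)))
        ((deriv h z / h z * (g z + (starRingEnd ℂ) (g 0)) - (g z - g 0) * (deriv h z / h z)) /
          (g z + (starRingEnd ℂ) (g 0)) ^ 2) z :=
    fun z hz => ((hg z hz).sub_const _).div ((hg z hz).add_const _) (hden z hz)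
  have hmaps : MapsTo (fun z => (g z - g 0) / (g z + (starRingEnd ℂ) (g 0)))
      (Metric.ball 0 1) (Metric.closedBall ((g 0 - g 0) / (g 0 + (starRingEnd ℂ) (g 0))) 1) := by
    intro z hz
    simp only [sub_self, zero_div, mem_closedBall_zero_iff, norm_div]
    apply div_le_one_of_le₀ _ (norm_nonneg _)
    rw [Complex.norm_def, Complex.norm_def]
    apply Real.sqrt_le_sqrt
    simp only [Complex.normSq_apply, Complex.sub_re, Complex.sub_im, Complex.add_re,
      Complex.add_im, Complex.conj_re, Complex.conj_im]
    nlinarith [mul_pos_of_neg_of_neg (hre z hz) (hre 0 hmem)]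
  have hS := Complex.norm_deriv_le_one_of_mapsTo_ball
    (fun z hz => (hk z hz).differentiableAt.differentiableWithinAt) hmaps one_pos
  rw [(hk 0 hmem).deriv] at hS
  have hsum : g 0 + (starRingEnd ℂ) (g 0) = ((2 * Real.log ‖h 0‖ : ℝ) : ℂ) := by
    rw [Complex.add_conj, hre0]
  have hlog : Real.log ‖h 0‖ < 0 := hre0 ▸ hre 0 hmem
  have hpos : 0 < ‖h 0‖ := norm_pos_iff.mpr (h0 0 hmem)
  have hnorm : ‖((2 * Real.log ‖h 0‖ : ℝ) : ℂ)‖ = 2 * -Real.log ‖h 0‖ := by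
    rw [Complex.norm_real, Real.norm_eq_abs, abs_of_neg (by linarith)]
    ring
  rw [sub_self, zero_mul, sub_zero, hsum, norm_div, norm_mul, norm_div, norm_pow, hnorm] at hS
  have hp2 : 0 < 2 * -Real.log ‖h 0‖ := by linarith
  rw [div_le_one (by positivity), pow_two] at hS
  have h3 := le_of_mul_le_mul_right hS hp2
  rw [div_le_iff₀ hpos] at h3
  linarith

/-- A holomorphic function on `Ω` with values in the punctured disc bounds the Kobayashi metric
from below. -/
theorem ofReal_le_kobayashiMetric {Ω : Set (ℂ × ℂ)} {φ : ℂ × ℂ → ℂ}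
    (hφ : ∀ p ∈ Ω, DifferentiableAt ℂ φ p) (h0 : ∀ p ∈ Ω, φ p ≠ 0) (h1 : ∀ p ∈ Ω, ‖φ p‖ < 1)
    (p : ℂ × ℂ) (ξ : ℂ × ℂ) :
    ENNReal.ofReal (‖fderiv ℂ φ p ξ‖ / (2 * ‖φ p‖ * -Real.log ‖φ p‖)) ≤
      kobayashiMetric Ω p ξ := by
  unfold kobayashiMetric
  refine le_iInf fun r => le_iInf fun hr => le_iInf fun ⟨f, hf, hmaps, hfp, hfξ⟩ => ?_
  apply ENNReal.ofReal_le_ofReal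
  have hmem : (0 : ℂ) ∈ Metric.ball (0 : ℂ) 1 := by simp
  have hp : p ∈ Ω := hfp ▸ hmaps hmem
  have hlog : Real.log ‖φ p‖ < 0 :=
    Real.log_neg (norm_pos_iff.mpr (h0 p hp)) (h1 p hp)
  have hpos : 0 < ‖φ p‖ := norm_pos_iff.mpr (h0 p hp)
  have hS := norm_deriv_le_of_mapsTo_punctured_ball (h := fun z => φ (f z))
    (fun z hz => ((hφ _ (hmaps hz)).comp z
      (hf.differentiableAt (Metric.isOpen_ball.mem_nhds hz))).differentiableWithinAt)
    (fun z hz => h0 _ (hmaps hz)) (fun z hz => h1 _ (hmaps hz))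
  have hder : deriv (fun z => φ (f z)) 0 = fderiv ℂ φ p (deriv f 0) := by
    have hf0 := (hf.differentiableAt (Metric.isOpen_ball.mem_nhds hmem)).hasDerivAt
    have hφ0 := (hφ (f 0) (hmaps hmem)).hasFDerivAt
    rw [← hfp]
    exact (hφ0.comp_hasDerivAt 0 hf0).deriv
  rw [hder, hfp] at hS
  have h2 : 0 < 2 * ‖φ p‖ * -Real.log ‖φ p‖ := by
    have : 0 < -Real.log ‖φ p‖ := by linarith
    positivity
  rw [div_le_iff₀ h2, ← hfξ]
  have : fderiv ℂ φ p (r • deriv f 0) = r • fderiv ℂ φ p (deriv f 0) := by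
    rw [← Complex.coe_smul r, map_smul, Complex.coe_smul]
  rw [this, norm_smul, Real.norm_eq_abs, abs_of_pos hr]
  exact mul_le_mul_of_nonneg_left hS hr.le

/-- The variation of a function that is differentiable off a countable set is bounded by the
(lower) integral of any majorant of its derivative. -/
theorem ofReal_abs_sub_le_lintegral {l : ℝ → ℝ} {k : ℝ → ℝ≥0∞} {s : Set ℝ} (hs : s.Countable)
    (hc : ContinuousOn l (Icc 0 1)) (hd : ∀ t ∈ Ioo (0 : ℝ) 1 \ s, DifferentiableAt ℝ l t)
    (hk : ∀ t ∈ Ioo (0 : ℝ) 1 \ s, ENNReal.ofReal |deriv l t| ≤ k t) :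
    ENNReal.ofReal |l 1 - l 0| ≤ ∫⁻ t in Icc (0 : ℝ) 1, k t := by
  have hae : ∀ᵐ t ∂(MeasureTheory.volume.restrict (Icc (0 : ℝ) 1)),
      ENNReal.ofReal |deriv l t| ≤ k t := by
    rw [MeasureTheory.ae_restrict_iff' measurableSet_Icc]
    have hcount : ({0, 1} ∪ s : Set ℝ).Countable := (by simp : ({0, 1} : Set ℝ).Countable).union hs
    filter_upwards [hcount.ae_notMem MeasureTheory.volume] with t ht htI
    simp only [mem_union, mem_insert_iff, mem_singleton_iff, not_or] at ht
    exact hk t ⟨⟨lt_of_le_of_ne htI.1 (Ne.symm ht.1.1), lt_of_le_of_ne htI.2 ht.1.2⟩, ht.2⟩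
  have hle : ∫⁻ t in Icc (0 : ℝ) 1, ENNReal.ofReal |deriv l t| ≤ ∫⁻ t in Icc (0 : ℝ) 1, k t :=
    MeasureTheory.lintegral_mono_ae hae
  refine le_trans ?_ hle
  -- Only a finite integral needs an argument; finiteness supplies the integrability required by the
  -- fundamental theorem of calculus.
  by_cases hfin : ∫⁻ t in Icc (0 : ℝ) 1, ENNReal.ofReal |deriv l t| = ⊤
  · simp [hfin]
  have hint : MeasureTheory.IntegrableOn (deriv l) (Icc 0 1) := by
    refine ⟨(measurable_deriv l).aestronglyMeasurable, ?_⟩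
    rw [MeasureTheory.hasFiniteIntegral_iff_norm]
    exact lt_top_iff_ne_top.mpr hfin
  have hftc := MeasureTheory.integral_eq_of_hasDerivAt_off_countable_of_le l (deriv l)
    zero_le_one hs hc (fun t ht => (hd t ht).hasDerivAt)
    ((intervalIntegrable_iff_integrableOn_Icc_of_le zero_le_one).mpr hint)
  rw [← hftc, intervalIntegral.integral_of_le zero_le_one,
    ← MeasureTheory.integral_Icc_eq_integral_Ioc]
  rw [← Real.norm_eq_abs]
  refine le_trans (ENNReal.ofReal_le_ofReal (MeasureTheory.norm_integral_le_integral_norm _)) ?_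
  rw [MeasureTheory.ofReal_integral_eq_lintegral_ofReal hint.norm
    (Eventually.of_forall fun _ => norm_nonneg _)]
  rfl

theorem IsPiecewiseSmooth.exists_countable_differentiableAt {γ : ℝ → ℂ × ℂ}
    (hγ : IsPiecewiseSmooth γ) :
    ∃ s : Set ℝ, s.Countable ∧ ∀ t ∈ Ioo (0 : ℝ) 1 \ s, DifferentiableAt ℝ γ t := by
  obtain ⟨-, n, t, -, ht0, ht1, hsm⟩ := hγ
  refine ⟨range t, countable_range t, ?_⟩
  rintro x ⟨⟨hx0, hx1⟩, hxs⟩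
  have hstep : ∃ i : Fin n, t i.castSucc < x ∧ x < t i.succ := by
    by_contra! hcon
    have hall : ∀ i : Fin (n + 1), t i < x := by
      intro i
      induction i using Fin.induction with
      | zero => rwa [ht0]
      | succ i ih => exact lt_of_le_of_ne (hcon i ih) fun h => hxs ⟨_, h⟩
    have := hall (Fin.last n)
    rw [ht1] at this
    linarith
  obtain ⟨i, hi1, hi2⟩ := hstep
  exact ((hsm i).differentiableOn (by simp)).differentiableAt (Icc_mem_nhds hi1 hi2)

/-- Up to sign, `log (-log r)` is a primitive of `1 / (r * -log r)`, twice the hyperbolic density of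
the punctured disc, and the modulus of a curve changes no faster than the curve. -/
theorem hasDerivAt_log_neg_log_norm {h : ℝ → ℂ} {h' : ℂ} {t : ℝ} (hd : HasDerivAt h h' t)
    (h0 : h t ≠ 0) (h1 : ‖h t‖ < 1) :
    ∃ d : ℝ, HasDerivAt (fun t => Real.log (-Real.log ‖h t‖)) d t ∧
      |d| ≤ ‖h'‖ / (‖h t‖ * -Real.log ‖h t‖) := by
  have hpos : 0 < ‖h t‖ := norm_pos_iff.mpr h0
  have hlog : 0 < -Real.log ‖h t‖ := by linarith [Real.log_neg hpos h1]
  have hnorm : ∃ e : ℝ, HasDerivAt (fun t => ‖h t‖) e t ∧ |e| ≤ ‖h'‖ := by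
    have hdn : DifferentiableAt ℝ (fun t => ‖h t‖) t := hd.differentiableAt.norm ℝ h0
    refine ⟨_, hdn.hasDerivAt, ?_⟩
    have h2 : HasDerivAt (fun t => ‖h t‖ ^ 2) (2 * inner ℝ (h t) h') t := hd.norm_sq
    have h3 := (hdn.hasDerivAt.pow 2).unique h2
    have h4 : ‖h t‖ * deriv (fun t => ‖h t‖) t = inner ℝ (h t) h' := by
      simp only [Nat.cast_ofNat, Nat.add_one_sub_one, pow_one] at h3
      linarith
    have h5 := abs_real_inner_le_norm (h t) h'
    rw [← h4, abs_mul, abs_of_pos hpos] at h5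
    exact le_of_mul_le_mul_left h5 hpos
  obtain ⟨e, he, hle⟩ := hnorm
  have hmain : HasDerivAt (fun t => Real.log (-Real.log ‖h t‖))
      (-(e / ‖h t‖) / -Real.log ‖h t‖) t :=
    (he.log hpos.ne').neg.log hlog.ne'
  refine ⟨_, hmain, ?_⟩
  rw [abs_div, abs_neg, abs_div, abs_of_pos hpos, abs_of_pos hlog, div_div]
  gcongr

/-- A holomorphic function on `Ω` with values in the punctured disc bounds the Kobayashi distance
from below by the hyperbolic distance of the punctured disc. -/
theorem ofReal_le_kobayashiDist {Ω : Set (ℂ × ℂ)} {φ : ℂ × ℂ → ℂ}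
    (hφ : ∀ p ∈ Ω, DifferentiableAt ℂ φ p) (h0 : ∀ p ∈ Ω, φ p ≠ 0) (h1 : ∀ p ∈ Ω, ‖φ p‖ < 1)
    (p q : ℂ × ℂ) :
    ENNReal.ofReal (|Real.log (-Real.log ‖φ q‖) - Real.log (-Real.log ‖φ p‖)| / 2) ≤
      kobayashiDist Ω p q := by
  unfold kobayashiDist
  refine le_iInf fun γ => le_iInf fun ⟨hγ, hmaps, hγ0, hγ1⟩ => ?_
  obtain ⟨s, hs, hsd⟩ := hγ.exists_countable_differentiableAt
  have hpos : ∀ t ∈ Icc (0 : ℝ) 1, 0 < ‖φ (γ t)‖ := fun t ht => norm_pos_iff.mpr (h0 _ (hmaps ht))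
  have hlog : ∀ t ∈ Icc (0 : ℝ) 1, 0 < -Real.log ‖φ (γ t)‖ := fun t ht => by
    linarith [Real.log_neg (hpos t ht) (h1 _ (hmaps ht))]
  have hcφ : ContinuousOn (fun t => φ (γ t)) (Icc 0 1) := by
    have : ContinuousOn φ Ω := fun p hp => (hφ p hp).continuousAt.continuousWithinAt
    exact this.comp hγ.1 hmaps
  have hc : ContinuousOn (fun t => Real.log (-Real.log ‖φ (γ t)‖) / 2) (Icc 0 1) :=
    (((hcφ.norm.log fun t ht => (hpos t ht).ne').neg).log
      fun t ht => (hlog t ht).ne').div_const 2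
  have hder : ∀ t ∈ Ioo (0 : ℝ) 1 \ s, ∃ d : ℝ,
      HasDerivAt (fun t => Real.log (-Real.log ‖φ (γ t)‖) / 2) d t ∧
      |d| ≤ ‖fderiv ℂ φ (γ t) (deriv γ t)‖ / (2 * ‖φ (γ t)‖ * -Real.log ‖φ (γ t)‖) := by
    intro t ht
    have htI := Ioo_subset_Icc_self ht.1
    have hφ0 := ((hφ (γ t) (hmaps htI)).hasFDerivAt.restrictScalars ℝ).comp_hasDerivAt t
      (hsd t ht).hasDerivAt
    obtain ⟨d, hd, hle⟩ := hasDerivAt_log_neg_log_norm hφ0 (h0 _ (hmaps htI)) (h1 _ (hmaps htI))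
    refine ⟨d / 2, hd.div_const 2, ?_⟩
    rw [abs_div, abs_two, div_le_iff₀ two_pos]
    refine hle.trans (le_of_eq ?_)
    simp only [Function.comp_apply, ContinuousLinearMap.coe_restrictScalars']
    have := (hpos t htI).ne'
    have := (hlog t htI).ne'
    field_simp
  have hmain := ofReal_abs_sub_le_lintegral
    (k := fun t => kobayashiMetric Ω (γ t) (deriv γ t)) hs hc
    (fun t ht => (hder t ht).choose_spec.1.differentiableAt) ?_
  · refine le_trans (le_of_eq ?_) hmain
    rw [hγ0, hγ1, ← sub_div, abs_div, abs_two]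
  · intro t ht
    obtain ⟨d, hd, hle⟩ := hder t ht
    rw [hd.deriv]
    exact (ENNReal.ofReal_le_ofReal hle).trans (ofReal_le_kobayashiMetric hφ h0 h1 _ _)

/-! ### Connectedness of the basin -/

/-- If `f` is open and closed and the fibre over one point of a preconnected open set `V` lies in a
preconnected subset of `f ⁻¹' V`, then `f ⁻¹' V` is preconnected. -/
theorem IsPreconnected.preimage_of_fiber_subset {X Y : Type*} [TopologicalSpace X]
    [TopologicalSpace Y] {f : X → Y} (hfo : IsOpenMap f) (hfc : IsClosedMap f)
    (hcont : Continuous f) {V : Set Y} (hVo : IsOpen V) (hV : IsPreconnected V) {y : Y}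
    (hy : y ∈ V) {S : Set X} (hS : IsPreconnected S) (hSV : S ⊆ f ⁻¹' V) (hfib : f ⁻¹' {y} ⊆ S) :
    IsPreconnected (f ⁻¹' V) := by
  have key : ∀ u v : Set X, IsOpen u → IsOpen v → f ⁻¹' V ⊆ u ∪ v → f ⁻¹' V ∩ (u ∩ v) = ∅ →
      S ⊆ u → f ⁻¹' V ⊆ u := by
    intro u v hu hv huv hdis hSu
    by_contra hne
    obtain ⟨x, hxV, hxu⟩ := not_subset.mp hne
    have hW : IsOpen (f ⁻¹' V ∩ v) := (hVo.preimage hcont).inter hv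
    -- The second set consists of the points whose whole fibre lies in `u`. Both sets are open and
    -- meet `V`, so connectedness gives a common point in `V`, which is absurd.
    have hcov : V ⊆ f '' (f ⁻¹' V ∩ v) ∪ (f '' uᶜ)ᶜ := by
      intro p hp
      by_cases hpu : p ∈ f '' uᶜ
      · obtain ⟨x', hx', rfl⟩ := hpu
        exact .inl ⟨x', ⟨hp, (huv hp).resolve_left hx'⟩, rfl⟩
      · exact .inr hpu
    obtain ⟨p, hpV, ⟨x', ⟨hx'V, hx'v⟩, rfl⟩, hp2⟩ := hV _ _ (hfo _ hW)
      (hfc _ hu.isClosed_compl).isOpen_compl hcov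
      ⟨f x, hxV, x, ⟨hxV, (huv hxV).resolve_left hxu⟩, rfl⟩
      ⟨y, hy, fun ⟨x', hx', hxy⟩ => hx' (hSu (hfib hxy))⟩
    have hx'u : x' ∉ u := fun h => by
      have : x' ∈ f ⁻¹' V ∩ (u ∩ v) := ⟨hx'V, h, hx'v⟩
      rw [hdis] at this
      exact this
    exact hp2 ⟨x', hx'u, rfl⟩
  rw [isPreconnected_iff_subset_of_disjoint]
  intro u v hu hv huv hdis
  have hS' := isPreconnected_iff_subset_of_disjoint.mp hS u v hu hv (hSV.trans huv)
    (subset_empty_iff.mp (hdis ▸ inter_subset_inter_left _ hSV))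
  rcases hS' with h | h
  · exact .inl (key u v hu hv huv hdis h)
  · exact .inr (key v u hv hu (by rwa [union_comm]) (by rwa [inter_comm v u]) h)

/-- The affine shear `(z, u) ↦ (z + s, u + t + b z)`. -/
def shearHomeomorph (b s t : ℂ) : ℂ × ℂ ≃ₜ ℂ × ℂ where
  toFun x := (x.1 + s, x.2 + t + b * x.1)
  invFun x := (x.1 - s, x.2 - t - b * (x.1 - s))
  left_inv x := by ext <;> simp; ring
  right_inv x := by ext <;> simp; ring
  continuous_toFun := by fun_prop
  continuous_invFun := by fun_prop

/-- Completing the square in each variable reduces openness and properness of `F` to those of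
squaring. -/
theorem skewMap_eq_comp (a b c : ℂ) :
    skewMap a b c = shearHomeomorph 0 (-(a / 2) ^ 2) 0 ∘ Prod.map (fun z => z ^ 2) id ∘
      shearHomeomorph b (a / 2) (-(c / 2) ^ 2) ∘ Prod.map id (fun w => w ^ 2) ∘
      shearHomeomorph 0 0 (c / 2) := by
  funext x
  ext <;> simp [skewMap, shearHomeomorph] <;> ring

theorem continuous_skewMap (a b c : ℂ) : Continuous (skewMap a b c) := by
  unfold skewMap
  fun_prop

theorem isOpenMap_skewMap (a b c : ℂ) : IsOpenMap (skewMap a b c) := by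
  have hsq : IsOpenMap (fun z : ℂ => z ^ 2) := (Complex.isOpenQuotientMap_pow 2).isOpenMap
  rw [skewMap_eq_comp]
  exact (shearHomeomorph _ _ _).isOpenMap.comp ((hsq.prodMap .id).comp
    ((shearHomeomorph _ _ _).isOpenMap.comp ((IsOpenMap.id.prodMap hsq).comp
      (shearHomeomorph _ _ _).isOpenMap)))

theorem isClosedMap_skewMap (a b c : ℂ) : IsClosedMap (skewMap a b c) := by
  have hsq : IsProperMap (fun z : ℂ => z ^ 2) := by
    have := (Polynomial.X ^ 2 : Polynomial ℂ).isProperMap_eval (by simp)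
    simpa using this
  rw [skewMap_eq_comp]
  exact ((shearHomeomorph _ _ _).isProperMap.comp ((hsq.prodMap isProperMap_id).comp
    ((shearHomeomorph _ _ _).isProperMap.comp ((isProperMap_id.prodMap hsq).comp
      (shearHomeomorph _ _ _).isProperMap)))).isClosedMap

theorem skewMap_zero (a b c : ℂ) : skewMap a b c 0 = 0 := by
  simp [skewMap]

section Basin

variable {a b c : ℂ}

theorem norm_skewMap_le (ha : ‖a‖ < 1 / 1000) (hb : ‖b‖ < 1 / 1000) (hc : ‖c‖ < 1 / 1000)
    {x : ℂ × ℂ} (hx : ‖x‖ < 1 / 2) : ‖skewMap a b c x‖ ≤ 4 / 5 * ‖x‖ := by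
  have h1 : ‖x.1‖ ≤ ‖x‖ := norm_fst_le x
  have h2 : ‖x.2‖ ≤ ‖x‖ := norm_snd_le x
  have p0 := norm_nonneg x
  have p1 := norm_nonneg x.1
  have p2 := norm_nonneg x.2
  rw [Prod.norm_def]
  apply max_le
  · calc ‖a * x.1 + x.1 ^ 2‖ ≤ ‖a‖ * ‖x.1‖ + ‖x.1‖ * ‖x.1‖ := by
          refine (norm_add_le _ _).trans ?_
          rw [norm_mul, norm_pow, pow_two]
      _ ≤ 1 / 1000 * ‖x‖ + 1 / 2 * ‖x‖ := by gcongr; linarith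
      _ ≤ 4 / 5 * ‖x‖ := by linarith
  · calc ‖x.2 ^ 2 + c * x.2 + b * x.1‖ ≤ ‖x.2‖ * ‖x.2‖ + ‖c‖ * ‖x.2‖ + ‖b‖ * ‖x.1‖ := by
          refine (norm_add₃_le).trans ?_
          rw [norm_mul, norm_mul, norm_pow, pow_two]
      _ ≤ 1 / 2 * ‖x‖ + 1 / 1000 * ‖x‖ + 1 / 1000 * ‖x‖ := by gcongr; linarith
      _ ≤ 4 / 5 * ‖x‖ := by linarith

theorem mapsTo_skewMap_ball (ha : ‖a‖ < 1 / 1000) (hb : ‖b‖ < 1 / 1000) (hc : ‖c‖ < 1 / 1000) :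
    MapsTo (skewMap a b c) (Metric.ball 0 (1 / 2)) (Metric.ball 0 (1 / 2)) := by
  intro x hx
  rw [mem_ball_zero_iff] at hx ⊢
  linarith [norm_skewMap_le ha hb hc hx, norm_nonneg x]

theorem ball_subset_basin (ha : ‖a‖ < 1 / 1000) (hb : ‖b‖ < 1 / 1000) (hc : ‖c‖ < 1 / 1000) :
    Metric.ball 0 (1 / 2) ⊆ basin (skewMap a b c) 0 := by
  intro x hx
  have hn : ∀ n : ℕ, ‖(skewMap a b c)^[n] x‖ ≤ (4 / 5) ^ n * ‖x‖ := by
    intro n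
    induction n with
    | zero => simp
    | succ n ih =>
      rw [Function.iterate_succ_apply']
      have hm := (mapsTo_skewMap_ball ha hb hc).iterate n hx
      rw [mem_ball_zero_iff] at hm
      refine (norm_skewMap_le ha hb hc hm).trans ?_
      rw [pow_succ]
      linarith
  refine squeeze_zero_norm hn ?_
  simpa using (tendsto_pow_atTop_nhds_zero_of_lt_one (r := (4 / 5 : ℝ))
    (by norm_num) (by norm_num)).mul_const ‖x‖

theorem mem_basin_iterate_iff {F : ℂ × ℂ → ℂ × ℂ} {p x : ℂ × ℂ} (n : ℕ) :
    F^[n] x ∈ basin F p ↔ x ∈ basin F p := by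
  simp only [basin, mem_ofPred_eq, ← Function.iterate_add_apply]
  exact tendsto_add_atTop_iff_nat (f := fun k => F^[k] x) n

theorem basin_eq_iUnion_preimage_ball (ha : ‖a‖ < 1 / 1000) (hb : ‖b‖ < 1 / 1000)
    (hc : ‖c‖ < 1 / 1000) :
    basin (skewMap a b c) 0 = ⋃ n : ℕ, (skewMap a b c)^[n] ⁻¹' Metric.ball 0 (1 / 2) := by
  ext x
  rw [mem_iUnion]
  constructor
  · intro hx
    exact (hx.eventually (Metric.ball_mem_nhds 0 (by norm_num : (0 : ℝ) < 1 / 2))).exists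
  · rintro ⟨n, hn⟩
    exact (mem_basin_iterate_iff n).mp (ball_subset_basin ha hb hc hn)

theorem skewMap_preimage_zero_subset (ha : ‖a‖ < 1 / 1000) (hb : ‖b‖ < 1 / 1000)
    (hc : ‖c‖ < 1 / 1000) : skewMap a b c ⁻¹' {0} ⊆ Metric.ball 0 (1 / 2) := by
  intro x hx
  have h1 : x.1 * (x.1 + a) = 0 := by
    have := congrArg Prod.fst (hx : skewMap a b c x = 0)
    simp only [skewMap, Prod.fst_zero] at this
    linear_combination this
  have h2 : x.2 ^ 2 = -(c * x.2) - b * x.1 := by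
    have := congrArg Prod.snd (hx : skewMap a b c x = 0)
    simp only [skewMap, Prod.snd_zero] at this
    linear_combination this
  have h3 : ‖x.1‖ ≤ ‖a‖ := by
    rcases mul_eq_zero.mp h1 with h | h
    · simp [h]
    · rw [eq_neg_of_add_eq_zero_left h, norm_neg]
  have h4 : ‖x.2‖ ^ 2 ≤ ‖c‖ * ‖x.2‖ + ‖b‖ * ‖x.1‖ := by
    rw [← norm_pow, h2, ← norm_mul, ← norm_mul]
    refine (norm_sub_le _ _).trans (by rw [norm_neg])
  have h5 : ‖x.2‖ < 1 / 2 := by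
    by_contra! h
    have : ‖b‖ * ‖x.1‖ ≤ 1 / 1000 * (1 / 1000) := by gcongr; linarith
    have : ‖c‖ * ‖x.2‖ ≤ 1 / 1000 * ‖x.2‖ := by gcongr
    nlinarith
  rw [mem_ball_zero_iff, Prod.norm_def]
  exact max_lt (by linarith) h5

/-- The ball is forward invariant, so it lies in each of these preimages, and it contains the fibre
over `0`; it is the set `S` of the fibre criterion. -/
theorem isPreconnected_iterate_preimage_ball (ha : ‖a‖ < 1 / 1000) (hb : ‖b‖ < 1 / 1000)
    (hc : ‖c‖ < 1 / 1000) (n : ℕ) :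
    IsPreconnected ((skewMap a b c)^[n] ⁻¹' Metric.ball 0 (1 / 2)) := by
  have hzero : ∀ n : ℕ, (skewMap a b c)^[n] 0 = 0 := fun n =>
    Function.iterate_fixed (skewMap_zero a b c) n
  induction n with
  | zero => exact (convex_ball (0 : ℂ × ℂ) (1 / 2)).isPreconnected
  | succ n ih =>
    rw [Function.iterate_succ, preimage_comp]
    refine ih.preimage_of_fiber_subset (isOpenMap_skewMap a b c) (isClosedMap_skewMap a b c)
      (continuous_skewMap a b c)
      (Metric.isOpen_ball.preimage ((continuous_skewMap a b c).iterate n))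
      (y := 0) ?_ (convex_ball (0 : ℂ × ℂ) (1 / 2)).isPreconnected ?_
      (skewMap_preimage_zero_subset ha hb hc)
    · simp [hzero n]
    · exact fun x hx => ((mapsTo_skewMap_ball ha hb hc).iterate n) (mapsTo_skewMap_ball ha hb hc hx)

theorem immediateBasin_skewMap (ha : ‖a‖ < 1 / 1000) (hb : ‖b‖ < 1 / 1000)
    (hc : ‖c‖ < 1 / 1000) :
    immediateBasin (skewMap a b c) 0 = basin (skewMap a b c) 0 := by
  have hzero : ∀ n : ℕ, (skewMap a b c)^[n] 0 = 0 := fun n =>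
    Function.iterate_fixed (skewMap_zero a b c) n
  refine IsPreconnected.connectedComponentIn ?_ ?_
  · rw [basin_eq_iUnion_preimage_ball ha hb hc]
    exact isPreconnected_iUnion ⟨0, mem_iInter.mpr fun n => by simp [hzero n]⟩
      (isPreconnected_iterate_preimage_ball ha hb hc)
  · exact ball_subset_basin ha hb hc (by simp)

theorem backwardOrbit_subset_basin (a b c : ℂ) :
    backwardOrbit (skewMap a b c) 0 ⊆ basin (skewMap a b c) 0 := by
  intro x hx
  obtain ⟨k, hk⟩ := mem_iUnion.mp hx
  rw [← mem_basin_iterate_iff k, (hk : (skewMap a b c)^[k] x = 0)]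
  have hzero : ∀ n : ℕ, (skewMap a b c)^[n] 0 = 0 := fun n =>
    Function.iterate_fixed (skewMap_zero a b c) n
  simp only [basin, mem_ofPred_eq, hzero]
  exact tendsto_const_nhds

end Basin

/-! ### Escape radii and the basin of the base map -/

theorem notMem_of_tendsto_of_mapsTo {X Y : Type*} [TopologicalSpace Y] {F : X → X} {g : X → Y}
    {S : Set Y} (hS : IsClosed S) (hF : MapsTo F (g ⁻¹' S) (g ⁻¹' S)) {x : X} {y : Y} (hy : y ∉ S)
    (hx : Tendsto (fun n : ℕ => g (F^[n] x)) atTop (𝓝 y)) : g x ∉ S :=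
  fun h => hy (hS.mem_of_tendsto hx (Eventually.of_forall fun n => hF.iterate n h))

theorem fst_skewMap_iterate_congr {a b c : ℂ} {x y : ℂ × ℂ} (h : x.1 = y.1) (n : ℕ) :
    ((skewMap a b c)^[n] x).1 = ((skewMap a b c)^[n] y).1 := by
  induction n with
  | zero => exact h
  | succ n ih => simp only [Function.iterate_succ_apply', skewMap, ih]

section Escape

variable {a b c : ℂ}

theorem norm_fst_lt_of_tendsto (ha : ‖a‖ < 1 / 1000) {x : ℂ × ℂ}
    (hx : Tendsto (fun n : ℕ => ((skewMap a b c)^[n] x).1) atTop (𝓝 0)) : ‖x.1‖ < 3 / 2 := by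
  have := notMem_of_tendsto_of_mapsTo (F := skewMap a b c) (g := Prod.fst)
    (S := {z : ℂ | 3 / 2 ≤ ‖z‖}) (isClosed_le continuous_const continuous_norm) ?_ (y := 0)
    (by norm_num) hx
  · simpa using this
  · intro y hy
    simp only [mem_preimage, mem_ofPred_eq, skewMap] at hy ⊢
    have h1 : ‖a * y.1 + y.1 ^ 2‖ ≥ ‖y.1‖ * ‖y.1‖ - ‖a‖ * ‖y.1‖ := by
      have := norm_sub_le (a * y.1 + y.1 ^ 2) (a * y.1)
      rw [add_sub_cancel_left, norm_pow, norm_mul] at this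
      linarith
    nlinarith [mul_nonneg (sub_nonneg.mpr ha.le) (norm_nonneg y.1)]

/-- While `|z| < 3/2` the disc `|w| ≤ 1/4` is preserved, so the orbit enters the ball as soon as `z`
is small. Thus `(z, 0) ∈ basin` expresses that `z` is in the basin of `P`. -/
theorem mem_basin_fst_zero_of_tendsto (ha : ‖a‖ < 1 / 1000) (hb : ‖b‖ < 1 / 1000)
    (hc : ‖c‖ < 1 / 1000) {x : ℂ × ℂ}
    (hx : Tendsto (fun n : ℕ => ((skewMap a b c)^[n] x).1) atTop (𝓝 0)) :
    (x.1, 0) ∈ basin (skewMap a b c) 0 := by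
  have hx' : Tendsto (fun n : ℕ => ((skewMap a b c)^[n] (x.1, 0)).1) atTop (𝓝 0) := by
    simpa only [fst_skewMap_iterate_congr (y := x) (x := (x.1, 0)) rfl] using hx
  have hz : ∀ n : ℕ, ‖((skewMap a b c)^[n] (x.1, 0)).1‖ < 3 / 2 := by
    intro n
    apply norm_fst_lt_of_tendsto (b := b) (c := c) ha
    simp only [← Function.iterate_add_apply]
    exact (tendsto_add_atTop_iff_nat
      (f := fun k => ((skewMap a b c)^[k] (x.1, 0)).1) n).mpr hx'
  have hw : ∀ n : ℕ, ‖((skewMap a b c)^[n] (x.1, 0)).2‖ ≤ 1 / 4 := by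
    intro n
    induction n with
    | zero => norm_num
    | succ n ih =>
      rw [Function.iterate_succ_apply']
      have hz := hz n
      generalize (skewMap a b c)^[n] (x.1, 0) = y at ih hz
      change ‖y.2 ^ 2 + c * y.2 + b * y.1‖ ≤ 1 / 4
      calc ‖y.2 ^ 2 + c * y.2 + b * y.1‖ ≤ ‖y.2‖ ^ 2 + ‖c‖ * ‖y.2‖ + ‖b‖ * ‖y.1‖ := by
            refine norm_add₃_le.trans ?_
            rw [norm_mul, norm_mul, norm_pow]
        _ ≤ (1 / 4) ^ 2 + 1 / 1000 * (1 / 4) + 1 / 1000 * (3 / 2) := by gcongr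
        _ ≤ 1 / 4 := by norm_num
  obtain ⟨n, hn⟩ := (hx'.eventually
    (Metric.ball_mem_nhds 0 (by norm_num : (0 : ℝ) < 1 / 2))).exists
  rw [← mem_basin_iterate_iff n]
  refine ball_subset_basin ha hb hc ?_
  rw [dist_zero_right] at hn
  rw [mem_ball_zero_iff]
  exact max_lt hn (lt_of_le_of_lt (hw n) (by norm_num))

theorem tendsto_fst_of_mem_basin {x : ℂ × ℂ} (hx : x ∈ basin (skewMap a b c) 0) :
    Tendsto (fun n : ℕ => ((skewMap a b c)^[n] x).1) atTop (𝓝 0) :=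
  (continuous_fst.tendsto (0 : ℂ × ℂ)).comp hx

theorem mem_basin_fst_zero (ha : ‖a‖ < 1 / 1000) (hb : ‖b‖ < 1 / 1000)
    (hc : ‖c‖ < 1 / 1000) {x : ℂ × ℂ} (hx : x ∈ basin (skewMap a b c) 0) :
    (x.1, 0) ∈ basin (skewMap a b c) 0 :=
  mem_basin_fst_zero_of_tendsto ha hb hc (tendsto_fst_of_mem_basin hx)

theorem norm_fst_lt_of_mem_basin (ha : ‖a‖ < 1 / 1000) {x : ℂ × ℂ}
    (hx : x ∈ basin (skewMap a b c) 0) : ‖x.1‖ < 3 / 2 :=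
  norm_fst_lt_of_tendsto ha (tendsto_fst_of_mem_basin hx)

theorem norm_snd_lt_of_mem_basin (ha : ‖a‖ < 1 / 1000) (hb : ‖b‖ < 1 / 1000)
    (hc : ‖c‖ < 1 / 1000) {x : ℂ × ℂ} (hx : x ∈ basin (skewMap a b c) 0) : ‖x.2‖ < 3 / 2 := by
  by_contra! h
  have hn : ∀ n : ℕ, 3 / 2 ≤ ‖((skewMap a b c)^[n] x).2‖ := by
    intro n
    induction n with
    | zero => exact h
    | succ n ih =>
      have hz := norm_fst_lt_of_mem_basin ha ((mem_basin_iterate_iff n).mpr hx)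
      rw [Function.iterate_succ_apply']
      generalize (skewMap a b c)^[n] x = y at ih hz
      have h1 : ‖y.2‖ * ‖y.2‖ ≤ ‖y.2 ^ 2 + c * y.2 + b * y.1‖ + ‖c‖ * ‖y.2‖ + ‖b‖ * ‖y.1‖ := by
        rw [← norm_mul, ← norm_mul, ← norm_mul]
        refine le_trans (le_of_eq ?_) ((norm_sub_le (y.2 ^ 2 + c * y.2 + b * y.1 - c * y.2)
          (b * y.1)).trans (add_le_add_left (norm_sub_le _ _) _))
        congr 1
        ring
      have h2 : ‖b‖ * ‖y.1‖ ≤ 1 / 1000 * (3 / 2) := by gcongr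
      have h3 : ‖c‖ * ‖y.2‖ ≤ 1 / 1000 * ‖y.2‖ := by gcongr
      change 3 / 2 ≤ ‖y.2 ^ 2 + c * y.2 + b * y.1‖
      nlinarith
  have hlim : Tendsto (fun n : ℕ => ((skewMap a b c)^[n] x).2) atTop (𝓝 0) :=
    (continuous_snd.tendsto (0 : ℂ × ℂ)).comp hx
  have := ge_of_tendsto' hlim.norm hn
  norm_num at this

end Escape

/-! ### Points that cannot lie in the backward orbit -/

section BackwardOrbit

variable {a b c : ℂ}

/-- Since `P(z) = z(z + a)`, the punctured disc `0 < |z| < |a|` is forward invariant. -/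
theorem norm_le_norm_fst_of_iterate_eq_zero (ha : ‖a‖ < 1 / 1000) {u : ℂ × ℂ} (h0 : u.1 ≠ 0)
    {k : ℕ} (hk : ((skewMap a b c)^[k] u).1 = 0) : ‖a‖ ≤ ‖u.1‖ := by
  by_contra! h
  have hmaps : MapsTo (skewMap a b c) {x | x.1 ≠ 0 ∧ ‖x.1‖ < ‖a‖} {x | x.1 ≠ 0 ∧ ‖x.1‖ < ‖a‖} := by
    rintro x ⟨hx0, hx⟩
    have heq : (skewMap a b c x).1 = x.1 * (x.1 + a) := by simp only [skewMap]; ring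
    have hne : x.1 + a ≠ 0 := fun h => by
      rw [eq_neg_of_add_eq_zero_left h, norm_neg] at hx
      exact lt_irrefl _ hx
    refine ⟨heq ▸ mul_ne_zero hx0 hne, ?_⟩
    rw [heq, norm_mul]
    have := norm_add_le x.1 a
    nlinarith [norm_nonneg x.1, norm_nonneg (x.1 + a)]
  exact (hmaps.iterate k ⟨h0, h⟩ : _ ∧ _).1 hk

/-- On the invariant fibre `z = 0` the map is `w(w + c)`, which preserves `0 < |w| < |c|`. -/
theorem iterate_ne_zero_of_norm_snd_lt (hc : ‖c‖ < 1 / 1000) {u : ℂ × ℂ} (h1 : u.1 = 0)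
    (h2 : u.2 ≠ 0) (h : ‖u.2‖ < ‖c‖) (k : ℕ) : (skewMap a b c)^[k] u ≠ 0 := by
  have hmaps : MapsTo (skewMap a b c) {x | x.1 = 0 ∧ x.2 ≠ 0 ∧ ‖x.2‖ < ‖c‖}
      {x | x.1 = 0 ∧ x.2 ≠ 0 ∧ ‖x.2‖ < ‖c‖} := by
    rintro x ⟨hx1, hx2, hx⟩
    have heq : (skewMap a b c x).2 = x.2 * (x.2 + c) := by simp only [skewMap, hx1]; ring
    have hne : x.2 + c ≠ 0 := fun h => by
      rw [eq_neg_of_add_eq_zero_left h, norm_neg] at hx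
      exact lt_irrefl _ hx
    refine ⟨by simp [skewMap, hx1], heq ▸ mul_ne_zero hx2 hne, ?_⟩
    rw [heq, norm_mul]
    have := norm_add_le x.2 c
    nlinarith [norm_nonneg x.2, norm_nonneg (x.2 + c)]
  intro hk
  have := (hmaps.iterate k ⟨h1, h2, h⟩ : _ ∧ _ ∧ _).2.1
  rw [hk] at this
  exact this rfl

/-- Near the slow direction the second coordinate follows `b z`, as long as `|z| ≥ |a|`. -/
theorem norm_snd_skewMap_sub_le (hc : ‖c‖ < 1 / 1000 * ‖a‖) (hb : ‖b‖ < 1 / 1000 * ‖a‖)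
    {u : ℂ × ℂ} (hu : ‖u.1‖ < 3 / 2)
    (h : ‖(skewMap a b c u).2 - b * u.1‖ ≤ ‖b‖ * ‖u.1‖ / 2)
    (ha : ‖a‖ ≤ ‖(skewMap a b c u).1‖) :
    ‖(skewMap a b c (skewMap a b c u)).2 - b * (skewMap a b c u).1‖ ≤
      ‖b‖ * ‖(skewMap a b c u).1‖ / 2 := by
  generalize skewMap a b c u = v at h ha
  have h1 : ‖v.2‖ ≤ 9 / 4 * ‖b‖ := by
    have h2 := norm_add_le (v.2 - b * u.1) (b * u.1)
    rw [sub_add_cancel, norm_mul] at h2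
    nlinarith [norm_nonneg b]
  have heq : (skewMap a b c v).2 - b * v.1 = v.2 * (v.2 + c) := by simp only [skewMap]; ring
  rw [heq, norm_mul]
  have h3 : ‖v.2 + c‖ ≤ 1 / 100 * ‖a‖ := by
    refine (norm_add_le _ _).trans ?_
    linarith [norm_nonneg a]
  calc ‖v.2‖ * ‖v.2 + c‖ ≤ 9 / 4 * ‖b‖ * (1 / 100 * ‖v.1‖) := by
        gcongr
        linarith
    _ ≤ ‖b‖ * ‖v.1‖ / 2 := by nlinarith [mul_nonneg (norm_nonneg b) (norm_nonneg v.1)]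

/-- Before its first zero the base orbit has modulus at least `|a|`, so `w` keeps following `b z` up
to `z = -a`. The next `w` is within `|ab|/2` of `-ab`, hence nonzero and below `|c|` in modulus. -/
theorem iterate_ne_zero_of_norm_snd_skewMap_sub_le (ha : ‖a‖ < 1 / 1000) (ha0 : 0 < ‖a‖)
    (hb0 : 0 < ‖b‖) (hc' : ‖c‖ < 1 / 1000)
    (hc : ‖c‖ < 1 / 1000 * ‖a‖) (hb : ‖b‖ < 1 / 1000 * ‖a‖) (hab : ‖a * b‖ < 1 / 1000 * ‖c‖)
    {u : ℂ × ℂ} (hu0 : u.1 ≠ 0) (hu : ∀ i : ℕ, ‖((skewMap a b c)^[i] u).1‖ < 3 / 2)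
    (h : ‖(skewMap a b c u).2 - b * u.1‖ ≤ ‖b‖ * ‖u.1‖ / 2) (k : ℕ) :
    (skewMap a b c)^[k] u ≠ 0 := by
  classical
  intro hk
  have hex : ∃ l : ℕ, ((skewMap a b c)^[l] u).1 = 0 := ⟨k, by rw [hk]; rfl⟩
  obtain ⟨l, hl⟩ : ∃ l, Nat.find hex = l + 1 :=
    Nat.exists_eq_succ_of_ne_zero fun h0 => hu0 (by simpa [h0] using Nat.find_spec hex)
  have hz : ((skewMap a b c)^[l + 1] u).1 = 0 := hl ▸ Nat.find_spec hex
  have hne : ∀ i ≤ l, ((skewMap a b c)^[i] u).1 ≠ 0 := fun i hi =>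
    Nat.find_min hex (by omega)
  have hlow : ∀ i ≤ l, ‖a‖ ≤ ‖((skewMap a b c)^[i] u).1‖ := by
    intro i hi
    refine norm_le_norm_fst_of_iterate_eq_zero (b := b) (c := c) (k := l + 1 - i) ha (hne i hi) ?_
    rw [← Function.iterate_add_apply, Nat.sub_add_cancel (by omega)]
    exact hz
  have hclose : ∀ i ≤ l, ‖((skewMap a b c) ((skewMap a b c)^[i] u)).2 -
      b * ((skewMap a b c)^[i] u).1‖ ≤ ‖b‖ * ‖((skewMap a b c)^[i] u).1‖ / 2 := by
    intro i
    induction i with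
    | zero => exact fun _ => h
    | succ i ih =>
      intro hi
      have h2 := hlow (i + 1) hi
      rw [Function.iterate_succ_apply'] at h2 ⊢
      exact norm_snd_skewMap_sub_le hc hb (hu i) (ih (by omega)) h2
  have hlast := hclose l le_rfl
  have hne' := hne l le_rfl
  have hzl : ((skewMap a b c)^[l] u).1 = -a := by
    rw [Function.iterate_succ_apply'] at hz
    have : ((skewMap a b c)^[l] u).1 * (((skewMap a b c)^[l] u).1 + a) = 0 := by
      simp only [skewMap] at hz ⊢
      linear_combination hz
    exact eq_neg_of_add_eq_zero_left ((mul_eq_zero.mp this).resolve_left hne')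
  rw [hzl, ← Function.iterate_succ_apply' (skewMap a b c), norm_neg] at hlast
  generalize hv : (skewMap a b c)^[l + 1] u = v at hz hlast
  have hpos : 0 < ‖b‖ * ‖a‖ := by positivity
  rw [norm_mul] at hab
  have hv2 : v.2 ≠ 0 := fun h0 => by
    rw [h0, zero_sub, norm_neg, norm_mul, norm_neg] at hlast
    linarith
  have hvc : ‖v.2‖ < ‖c‖ := by
    have h2 := norm_add_le (v.2 - b * -a) (b * -a)
    rw [sub_add_cancel, norm_mul, norm_neg] at h2
    nlinarith [norm_nonneg c]
  have hkl : l + 1 ≤ k := hl ▸ Nat.find_min' hex (by rw [hk]; rfl)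
  apply iterate_ne_zero_of_norm_snd_lt (a := a) (b := b) hc' hz hv2 hvc (k - (l + 1))
  rw [← hv, ← Function.iterate_add_apply, Nat.sub_add_cancel hkl, hk]

/-- A point of the backward orbit whose first coordinate stays away from `0` for a while cannot
have a small second coordinate. -/
theorem iterate_ne_zero_of_norm_snd_le (ha : ‖a‖ < 1 / 1000) (ha0 : 0 < ‖a‖)
    (hb0 : 0 < ‖b‖) (hc' : ‖c‖ < 1 / 1000)
    (hc : ‖c‖ < 1 / 1000 * ‖a‖) (hb : ‖b‖ < 1 / 1000 * ‖a‖) (hab : ‖a * b‖ < 1 / 1000 * ‖c‖)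
    {m : ℕ} (hm : (17 / 20 : ℝ) ^ m ≤ ‖b‖)
    {u : ℂ × ℂ} (hu : ∀ i : ℕ, ‖((skewMap a b c)^[i] u).1‖ < 3 / 2)
    (hlow : 1 / 4 ≤ ‖((skewMap a b c)^[m] u).1‖) (hu2 : ‖u.2‖ ≤ 4 / 5) (k : ℕ) :
    (skewMap a b c)^[k] u ≠ 0 := by
  -- The recursion is `r ↦ (17/20) r + (3/2)|b|`, with fixed point `10|b|`.
  have hw : ∀ i : ℕ, ‖((skewMap a b c)^[i] u).2‖ ≤ 4 / 5 ∧
      ‖((skewMap a b c)^[i] u).2‖ ≤ (17 / 20) ^ i + 10 * ‖b‖ := by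
    intro i
    induction i with
    | zero => exact ⟨hu2, by simp only [Function.iterate_zero, id_eq, pow_zero]; linarith⟩
    | succ i ih =>
      obtain ⟨ih1, ih2⟩ := ih
      have hz := hu i
      rw [Function.iterate_succ_apply', pow_succ]
      generalize (skewMap a b c)^[i] u = y at ih1 ih2 hz
      have hstep : ‖(skewMap a b c y).2‖ ≤ 17 / 20 * ‖y.2‖ + 3 / 2 * ‖b‖ := by
        calc ‖y.2 ^ 2 + c * y.2 + b * y.1‖ ≤ ‖y.2‖ * ‖y.2‖ + ‖c‖ * ‖y.2‖ + ‖b‖ * ‖y.1‖ := by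
              refine norm_add₃_le.trans ?_
              rw [norm_mul, norm_mul, norm_pow, pow_two]
          _ ≤ 4 / 5 * ‖y.2‖ + 1 / 1000 * ‖y.2‖ + ‖b‖ * (3 / 2) := by gcongr
          _ ≤ 17 / 20 * ‖y.2‖ + 3 / 2 * ‖b‖ := by linarith [norm_nonneg y.2]
      exact ⟨by linarith, by linarith⟩
  have hwm := (hw m).2
  intro hk
  have hnext : (skewMap a b c)^[k] ((skewMap a b c)^[m] u) = 0 := by
    rw [← Function.iterate_add_apply, add_comm, Function.iterate_add_apply, hk]
    exact Function.iterate_fixed (skewMap_zero a b c) m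
  refine iterate_ne_zero_of_norm_snd_skewMap_sub_le ha ha0 hb0 hc' hc hb hab ?_ ?_ ?_ k hnext
  · rw [← norm_pos_iff]
    linarith
  · intro i
    rw [← Function.iterate_add_apply]
    exact hu _
  -- The tracking estimate starts here: `|w(w + c)| ≤ 0.11|b|`, while `|z| ≥ 1/4` allows `|b|/8`.
  · generalize (skewMap a b c)^[m] u = v at hwm hlow
    have heq : (skewMap a b c v).2 - b * v.1 = v.2 * (v.2 + c) := by simp only [skewMap]; ring
    have hv : ‖v.2‖ ≤ 11 * ‖b‖ := by linarith
    have h3 : ‖v.2 + c‖ ≤ 1 / 100 := by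
      refine (norm_add_le _ _).trans ?_
      linarith
    rw [heq, norm_mul]
    calc ‖v.2‖ * ‖v.2 + c‖ ≤ 11 * ‖b‖ * (1 / 100) := by gcongr
      _ ≤ ‖b‖ * ‖v.1‖ / 2 := by nlinarith

end BackwardOrbit

/-! ### Inverse branches and graphs avoiding the basin -/

theorem Complex.cpow_half_re_nonneg {u : ℂ} (hu : u ≠ 0) : 0 ≤ (u ^ (1 / 2 : ℂ)).re := by
  rw [Complex.cpow_def_of_ne_zero hu, Complex.exp_re]
  have him : (Complex.log u * (1 / 2)).im = Complex.arg u / 2 := by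
    rw [← Complex.log_im, mul_one_div, Complex.div_ofNat_im]
  rw [him]
  refine mul_nonneg (Real.exp_pos _).le (Real.cos_nonneg_of_mem_Icc ⟨?_, ?_⟩)
  · linarith [Complex.neg_pi_lt_arg u]
  · linarith [Complex.arg_le_pi u]

/-- For the root `σ`, `(σ - 1)(σ + 1) = u - 1`. First `Re σ ≥ 0` gives `|σ + 1| ≥ 1` and `|σ - 1| ≤
r`; this improves the former to `|σ + 1| ≥ 2 - r`. The near-halving of the error lets the bound
`1/20` reproduce itself under pull-back. -/
theorem Complex.norm_cpow_half_sub_one_le {u : ℂ} {r : ℝ} (hr : r < 1) (hu : ‖u - 1‖ ≤ r) :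
    ‖u ^ (1 / 2 : ℂ) - 1‖ ≤ r / (2 - r) := by
  have hu0 : u ≠ 0 := by
    rintro rfl
    norm_num at hu
    linarith
  have hsq : (u ^ (1 / 2 : ℂ)) ^ 2 = u := by
    rw [one_div]
    exact_mod_cast Complex.cpow_nat_inv_pow u two_ne_zero
  have hre := Complex.cpow_half_re_nonneg hu0
  generalize u ^ (1 / 2 : ℂ) = σ at hsq hre
  have hprod : ‖σ - 1‖ * ‖σ + 1‖ = ‖u - 1‖ := by
    rw [← norm_mul, ← hsq]
    congr 1
    ring
  have h1 : 1 ≤ ‖σ + 1‖ := by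
    refine le_trans ?_ (Complex.re_le_norm _)
    simp only [Complex.add_re, Complex.one_re]
    linarith
  have h2 : ‖σ - 1‖ ≤ r := by nlinarith [norm_nonneg (σ - 1)]
  have h3 : 2 - r ≤ ‖σ + 1‖ := by
    have := norm_sub_le (σ + 1) (σ - 1)
    have h4 : ‖σ + 1 - (σ - 1)‖ = 2 := by ring_nf; norm_num
    linarith
  rw [le_div_iff₀ (by linarith)]
  nlinarith [norm_nonneg (σ - 1)]

theorem exists_sq_eq_norm_sub_le (t' w : ℂ) : ∃ t : ℂ, t ^ 2 = t' ∧ ‖t - w‖ ≤ ‖t + w‖ := by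
  obtain ⟨t, ht⟩ := IsAlgClosed.exists_pow_nat_eq t' two_pos
  rcases le_total ‖t - w‖ ‖t + w‖ with h | h
  · exact ⟨t, ht, h⟩
  · refine ⟨-t, by rw [neg_sq, ht], ?_⟩
    rwa [← norm_neg (-t - w), ← norm_neg (-t + w), neg_sub, neg_add, neg_neg, sub_neg_eq_add,
      ← sub_eq_add_neg, add_comm w t]

/-- A holomorphic inverse branch of the fibre maps of a skew product. -/
theorem exists_fiber_inverse_branch {b c t t' : ℂ} (hb : ‖b‖ < 1 / 1000) (hc : ‖c‖ < 1 / 1000)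
    (ht : t ^ 2 = t') (ht1 : 1 ≤ ‖t'‖) (ht2 : ‖t'‖ ≤ 2) {s' P : ℂ → ℂ} :
    ∃ s : ℂ → ℂ, ∀ z : ℂ, ‖z‖ < 3 / 2 → DifferentiableAt ℂ P z → DifferentiableAt ℂ s' (P z) →
      ‖s' (P z) - t'‖ ≤ 1 / 20 → DifferentiableAt ℂ s z ∧ ‖s z - t‖ ≤ 1 / 20 ∧
        s z ^ 2 + c * s z + b * z = s' (P z) := by
  -- This solves the quadratic equation for `s z`; dividing by `t' = t²` brings the radicand near
  -- `1`, where the principal root is holomorphic.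
  refine ⟨fun z => -c / 2 + t * ((s' (P z) - b * z + c ^ 2 / 4) / t') ^ (1 / 2 : ℂ),
    fun z hz hP hs' hst => ?_⟩
  have ht0 : t' ≠ 0 := norm_pos_iff.mp (by linarith)
  have hnt : ‖t‖ ≤ 3 / 2 := by
    rw [← ht, norm_pow] at ht2
    nlinarith [norm_nonneg t]
  have hu : ‖(s' (P z) - b * z + c ^ 2 / 4) / t' - 1‖ ≤ 52 / 1000 := by
    rw [div_sub_one ht0, norm_div, div_le_iff₀ (by linarith)]
    have h1 : s' (P z) - b * z + c ^ 2 / 4 - t' = (s' (P z) - t') + -(b * z) + c ^ 2 / 4 := by ring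
    rw [h1]
    refine norm_add₃_le.trans ?_
    have h2 : ‖-(b * z)‖ ≤ 1 / 1000 * (3 / 2) := by
      rw [norm_neg, norm_mul]
      gcongr
    have h3 : ‖c ^ 2 / 4‖ ≤ 1 / 1000 * (1 / 1000) := by
      rw [norm_div, norm_pow, pow_two, Complex.norm_ofNat]
      have : ‖c‖ * ‖c‖ ≤ 1 / 1000 * (1 / 1000) := by gcongr
      linarith
    linarith
  have hslit : (s' (P z) - b * z + c ^ 2 / 4) / t' ∈ Complex.slitPlane := by
    left
    have := (abs_le.mp ((Complex.abs_re_le_norm _).trans hu)).1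
    simp only [Complex.sub_re, Complex.one_re] at this
    linarith
  refine ⟨?_, ?_, ?_⟩
  · have hcomp : DifferentiableAt ℂ (fun z => s' (P z)) z := hs'.comp z hP
    have hin : DifferentiableAt ℂ (fun z => (s' (P z) - b * z + c ^ 2 / 4) / t') z := by fun_prop
    exact ((hin.cpow (differentiableAt_const _) hslit).const_mul t).const_add _
  · beta_reduce
    have hσ := Complex.norm_cpow_half_sub_one_le (by norm_num) hu
    generalize ((s' (P z) - b * z + c ^ 2 / 4) / t') ^ (1 / 2 : ℂ) = σ at hσ
    have h1 : -c / 2 + t * σ - t = t * (σ - 1) - c / 2 := by ring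
    rw [h1]
    refine (norm_sub_le _ _).trans ?_
    rw [norm_mul, norm_div, Complex.norm_ofNat]
    have : ‖t‖ * ‖σ - 1‖ ≤ 3 / 2 * (52 / 1000 / (2 - 52 / 1000)) := by gcongr
    norm_num at this ⊢
    linarith
  · have hsq : (((s' (P z) - b * z + c ^ 2 / 4) / t') ^ (1 / 2 : ℂ)) ^ 2 =
        (s' (P z) - b * z + c ^ 2 / 4) / t' := by
      rw [one_div]
      exact_mod_cast Complex.cpow_nat_inv_pow _ two_ne_zero
    beta_reduce
    generalize ((s' (P z) - b * z + c ^ 2 / 4) / t') ^ (1 / 2 : ℂ) = σ at hsq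
    rw [eq_div_iff ht0] at hsq
    rw [← ht] at hsq
    linear_combination hsq

/-- With the root `t` nearer to `w`, the parallelogram law gives `|t + w|² ≥ |t|² + |w|²`. The
resulting bound exceeds `1`, which makes the pull-back contract distances along the fibre. -/
theorem six_fifths_le_norm_add {s t w c : ℂ} (hc : ‖c‖ < 1 / 1000) (hs : ‖s - t‖ ≤ 1 / 20)
    (ht : 1 ≤ ‖t‖) (hw : 4 / 5 ≤ ‖w‖) (h : ‖t - w‖ ≤ ‖t + w‖) : 6 / 5 ≤ ‖s + w + c‖ := by
  have hpar := parallelogram_law_with_norm ℝ t w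
  have h1 : 128 / 100 ≤ ‖t + w‖ := by nlinarith [norm_nonneg (t + w), norm_nonneg (t - w)]
  have h2 : ‖t + w‖ ≤ ‖s + w + c‖ + ‖s - t‖ + ‖c‖ := by
    have : t + w = (s + w + c) - (s - t) - c := by ring
    rw [this]
    exact (norm_sub_le _ _).trans (add_le_add_left (norm_sub_le _ _) _)
  linarith

theorem skewMap_mem_basin_iff {a b c : ℂ} {x : ℂ × ℂ} :
    skewMap a b c x ∈ basin (skewMap a b c) 0 ↔ x ∈ basin (skewMap a b c) 0 :=
  mem_basin_iterate_iff (F := skewMap a b c) 1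

/-- If the second coordinate of a point stays large for `n` steps, then close to the point there is
the graph of a holomorphic function that avoids the basin. -/
theorem exists_section_avoiding_basin {a b c : ℂ} (ha : ‖a‖ < 1 / 1000) (hb : ‖b‖ < 1 / 1000)
    (hc : ‖c‖ < 1 / 1000) (n : ℕ) : ∀ x ∈ basin (skewMap a b c) 0,
      (∀ j < n, 4 / 5 ≤ ‖((skewMap a b c)^[j] x).2‖) →
      ∃ (s : ℂ → ℂ) (t : ℂ), 1 ≤ ‖t‖ ∧ ‖t‖ ≤ 2 ∧
        (∀ z : ℂ, (z, 0) ∈ basin (skewMap a b c) 0 →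
          DifferentiableAt ℂ s z ∧ ‖s z - t‖ ≤ 1 / 20) ∧
        (∀ y ∈ basin (skewMap a b c) 0, s y.1 ≠ y.2) ∧
        ‖s x.1 - x.2‖ ≤ 4 * (5 / 6) ^ n := by
  induction n with
  | zero =>
    intro x hx _
    -- The graph `w = 2` is outside the basin, where `|w| < 3/2`.
    refine ⟨fun _ => 2, 2, by simp, by simp, fun z _ => ⟨differentiableAt_const _, by norm_num⟩,
      fun y hy h => ?_, ?_⟩
    · have := norm_snd_lt_of_mem_basin ha hb hc hy
      rw [← h] at this
      norm_num at this
    · have := norm_snd_lt_of_mem_basin ha hb hc hx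
      refine (norm_sub_le _ _).trans ?_
      norm_num
      linarith
  | succ n ih =>
    intro x hx hlarge
    obtain ⟨s', t', ht1, ht2, hs', havoid, hclose⟩ := ih (skewMap a b c x)
      (skewMap_mem_basin_iff.mpr hx) fun j hj => by
        rw [← Function.iterate_succ_apply]
        exact hlarge (j + 1) (by omega)
    obtain ⟨t, ht, hsign⟩ := exists_sq_eq_norm_sub_le t' x.2
    obtain ⟨s, hs⟩ := exists_fiber_inverse_branch hb hc ht ht1 ht2 (s' := s')
      (P := fun z => a * z + z ^ 2)
    have hspec : ∀ z : ℂ, (z, 0) ∈ basin (skewMap a b c) 0 → DifferentiableAt ℂ s z ∧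
        ‖s z - t‖ ≤ 1 / 20 ∧ s z ^ 2 + c * s z + b * z = s' (a * z + z ^ 2) := by
      intro z hz
      have hP : (a * z + z ^ 2, 0) ∈ basin (skewMap a b c) 0 :=
        mem_basin_fst_zero ha hb hc (skewMap_mem_basin_iff.mpr hz)
      exact hs z (norm_fst_lt_of_mem_basin ha hz) (by fun_prop) (hs' _ hP).1 (hs' _ hP).2
    have hx1 := hspec x.1 (mem_basin_fst_zero ha hb hc hx)
    rw [← ht, norm_pow] at ht1 ht2
    have htl : 1 ≤ ‖t‖ := by nlinarith [norm_nonneg t]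
    refine ⟨s, t, htl, by nlinarith [norm_nonneg t],
      fun z hz => ⟨(hspec z hz).1, (hspec z hz).2.1⟩, fun y hy h => ?_, ?_⟩
    · refine havoid _ (skewMap_mem_basin_iff.mpr hy) ?_
      have := (hspec y.1 (mem_basin_fst_zero ha hb hc hy)).2.2
      rw [h] at this
      exact this.symm
    · have hfac := six_fifths_le_norm_add hc hx1.2.1 htl (hlarge 0 (by omega)) hsign
      simp only [Function.iterate_zero, id_eq] at hfac
      -- Subtracting the fibre map at `w` from its value at `s` gives `(s - w)(s + w + c)`.
      have hprod : ‖s x.1 - x.2‖ * ‖s x.1 + x.2 + c‖ =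
          ‖s' (skewMap a b c x).1 - (skewMap a b c x).2‖ := by
        rw [← norm_mul]
        congr 1
        simp only [skewMap]
        linear_combination hx1.2.2
      rw [← hprod] at hclose
      rw [pow_succ]
      nlinarith [norm_nonneg (s x.1 - x.2)]

/-! ### The two distance estimates and the conclusion -/

theorem le_log_neg_log {r M : ℝ} (h0 : 0 < r) (h : r ≤ Real.exp (-Real.exp M)) :
    M ≤ Real.log (-Real.log r) := by
  have h1 := Real.log_le_log h0 h
  rw [Real.log_exp] at h1
  rw [Real.le_log_iff_exp_le (by linarith [Real.exp_pos M])]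
  linarith

theorem log_neg_log_le {r e : ℝ} (he : 0 < e) (h : e ≤ r) (h1 : r < 1) :
    Real.log (-Real.log r) ≤ -Real.log e := by
  have hr : 0 < r := he.trans_le h
  have h2 := Real.log_neg hr h1
  have h3 := Real.log_le_log he h
  linarith [Real.log_le_sub_one_of_pos (neg_pos.mpr h2)]

/-- Points of the basin whose first coordinates are far apart relative to a boundary point `β` of
the basin of the base map are far apart for the Kobayashi distance. -/
theorem ofReal_le_kobayashiDist_of_fst {a b c β : ℂ} (ha : ‖a‖ < 1 / 1000) (hb : ‖b‖ < 1 / 1000)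
    (hc : ‖c‖ < 1 / 1000) (hβ : (β, 0) ∉ basin (skewMap a b c) 0) (hβn : ‖β‖ ≤ 3 / 2)
    {p q : ℂ × ℂ} (hp : p ∈ basin (skewMap a b c) 0) (hq : q ∈ basin (skewMap a b c) 0)
    {C η : ℝ} (hη : 0 < η) (hqη : η ≤ ‖q.1 - β‖)
    (hpη : ‖p.1 - β‖ ≤ Real.exp (-Real.exp (2 * C - Real.log (η / 4)))) :
    ENNReal.ofReal C ≤ kobayashiDist (basin (skewMap a b c) 0) p q := by
  have hne : ∀ y ∈ basin (skewMap a b c) 0, (y.1 - β) / 4 ≠ 0 := by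
    intro y hy h
    have h2 : y.1 - β = 0 := by simpa using h
    have := mem_basin_fst_zero ha hb hc hy
    rw [sub_eq_zero.mp h2] at this
    exact hβ this
  have hlt : ∀ y ∈ basin (skewMap a b c) 0, ‖(y.1 - β) / 4‖ < 1 := by
    intro y hy
    rw [norm_div, Complex.norm_ofNat]
    have := norm_sub_le y.1 β
    linarith [norm_fst_lt_of_mem_basin ha hy]
  refine le_trans (ENNReal.ofReal_le_ofReal ?_) (ofReal_le_kobayashiDist
    (φ := fun y => (y.1 - β) / 4) (fun y _ => by fun_prop) hne hlt p q)
  have h1 : Real.log (-Real.log ‖(q.1 - β) / 4‖) ≤ -Real.log (η / 4) := by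
    refine log_neg_log_le (by linarith) ?_ (hlt q hq)
    rw [norm_div, Complex.norm_ofNat]
    linarith
  have h2 : 2 * C - Real.log (η / 4) ≤ Real.log (-Real.log ‖(p.1 - β) / 4‖) := by
    refine le_log_neg_log (norm_pos_iff.mpr (hne p hp)) ?_
    rw [norm_div, Complex.norm_ofNat]
    linarith [norm_nonneg (p.1 - β)]
  have h3 := neg_abs_le (Real.log (-Real.log ‖(q.1 - β) / 4‖) -
    Real.log (-Real.log ‖(p.1 - β) / 4‖))
  linarith

/-- A point of the basin whose second coordinate stays large for a long time is far from all points
with second coordinate `0`. -/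
theorem ofReal_le_kobayashiDist_of_snd {a b c : ℂ} (ha : ‖a‖ < 1 / 1000) (hb : ‖b‖ < 1 / 1000)
    (hc : ‖c‖ < 1 / 1000) {z₀ : ℂ} {q : ℂ × ℂ} (hp : (z₀, 0) ∈ basin (skewMap a b c) 0)
    (hq : q ∈ basin (skewMap a b c) 0) {C : ℝ} {n : ℕ}
    (hn : (5 / 6 : ℝ) ^ n ≤ Real.exp (-Real.exp (2 * C - Real.log (1 / 5))))
    (hlarge : ∀ j < n, 4 / 5 ≤ ‖((skewMap a b c)^[j] q).2‖) :
    ENNReal.ofReal C ≤ kobayashiDist (basin (skewMap a b c) 0) (z₀, 0) q := by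
  obtain ⟨s, t, ht1, ht2, hs, havoid, hclose⟩ :=
    exists_section_avoiding_basin ha hb hc n q hq hlarge
  have hmem : ∀ y ∈ basin (skewMap a b c) 0, (y.1, 0) ∈ basin (skewMap a b c) 0 :=
    fun y hy => mem_basin_fst_zero ha hb hc hy
  have hne : ∀ y ∈ basin (skewMap a b c) 0, (s y.1 - y.2) / 4 ≠ 0 := fun y hy =>
    div_ne_zero (sub_ne_zero.mpr (havoid y hy)) (by norm_num)
  have hlt : ∀ y ∈ basin (skewMap a b c) 0, ‖(s y.1 - y.2) / 4‖ < 1 := by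
    intro y hy
    rw [norm_div, Complex.norm_ofNat]
    have h1 := norm_sub_le (s y.1) y.2
    have h2 := norm_add_le (s y.1 - t) t
    rw [sub_add_cancel] at h2
    linarith [norm_snd_lt_of_mem_basin ha hb hc hy, (hs y.1 (hmem y hy)).2]
  refine le_trans (ENNReal.ofReal_le_ofReal ?_) (ofReal_le_kobayashiDist
    (φ := fun y => (s y.1 - y.2) / 4) (fun y hy => ?_) hne hlt (z₀, 0) q)
  -- Since `|s z₀| ≥ 1 - 1/20`, the value at `(z₀, 0)` has modulus at least `1/5`, whatever `z₀` is.
  · have h1 : Real.log (-Real.log ‖(s z₀ - 0) / 4‖) ≤ -Real.log (1 / 5) := by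
      refine log_neg_log_le (by norm_num) ?_ (hlt _ hp)
      rw [norm_div, Complex.norm_ofNat, sub_zero]
      have := norm_sub_le (s z₀) (s z₀ - t)
      rw [sub_sub_cancel] at this
      linarith [(hs z₀ hp).2]
    have h2 : 2 * C - Real.log (1 / 5) ≤ Real.log (-Real.log ‖(s q.1 - q.2) / 4‖) := by
      refine le_log_neg_log (norm_pos_iff.mpr (hne q hq)) ?_
      rw [norm_div, Complex.norm_ofNat]
      linarith
    have h3 := le_abs_self (Real.log (-Real.log ‖(s q.1 - q.2) / 4‖) -
      Real.log (-Real.log ‖(s z₀ - 0) / 4‖))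
    simp only
    linarith
  · have hsy : DifferentiableAt ℂ (fun y : ℂ × ℂ => s y.1) y :=
      (hs y.1 (hmem y hy)).1.comp y differentiableAt_fst
    have hsub : DifferentiableAt ℂ (fun y : ℂ × ℂ => s y.1 - y.2) y :=
      hsy.sub differentiableAt_snd
    simpa only [div_eq_mul_inv] using hsub.mul_const (4 : ℂ)⁻¹

/-- The basin of `0` under `z ↦ a z + z²` has a boundary point, whose orbit stays away from `0`. -/
theorem exists_boundary_point {a b c : ℂ} (ha : ‖a‖ < 1 / 1000) (hb : ‖b‖ < 1 / 1000)
    (hc : ‖c‖ < 1 / 1000) :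
    ∃ β : ℂ, (β, 0) ∉ basin (skewMap a b c) 0 ∧
      (∀ ε > 0, ∃ z : ℂ, (z, 0) ∈ basin (skewMap a b c) 0 ∧ ‖z - β‖ < ε) ∧
      ∀ n : ℕ, 1 / 2 ≤ ‖((skewMap a b c)^[n] (β, 0)).1‖ := by
  have hcont := continuous_skewMap a b c
  have hopen : IsOpen {z : ℂ | (z, (0 : ℂ)) ∈ basin (skewMap a b c) 0} := by
    have : IsOpen (basin (skewMap a b c) 0) := by
      rw [basin_eq_iUnion_preimage_ball ha hb hc]
      exact isOpen_iUnion fun n => Metric.isOpen_ball.preimage (hcont.iterate n)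
    exact this.preimage (by fun_prop)
  have hfr : (frontier {z : ℂ | (z, (0 : ℂ)) ∈ basin (skewMap a b c) 0}).Nonempty := by
    rw [nonempty_frontier_iff]
    refine ⟨⟨0, ball_subset_basin ha hb hc (by simp)⟩, fun h => ?_⟩
    have h2 : (2 : ℂ) ∈ {z : ℂ | (z, (0 : ℂ)) ∈ basin (skewMap a b c) 0} := h ▸ mem_univ _
    have := norm_fst_lt_of_mem_basin ha h2
    norm_num at this
  obtain ⟨β, hβ⟩ := hfr
  rw [hopen.frontier_eq] at hβ
  refine ⟨β, hβ.2, fun ε hε => ?_, fun n => ?_⟩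
  · obtain ⟨z, hz, hd⟩ := Metric.mem_closure_iff.mp hβ.1 ε hε
    exact ⟨z, hz, by rwa [← dist_eq_norm, dist_comm]⟩
  · by_contra! h
    apply hβ.2
    refine mem_basin_fst_zero_of_tendsto ha hb hc (x := (β, 0)) ?_
    have hmem : (((skewMap a b c)^[n] (β, 0)).1, (0 : ℂ)) ∈ basin (skewMap a b c) 0 := by
      refine ball_subset_basin ha hb hc ?_
      rw [mem_ball_zero_iff]
      exact max_lt h (by norm_num)
    have hlim := tendsto_fst_of_mem_basin hmem
    rw [← tendsto_add_atTop_iff_nat n]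
    simp only [Function.iterate_add_apply]
    simpa only [fst_skewMap_iterate_congr (x := (((skewMap a b c)^[n] (β, 0)).1, (0 : ℂ)))
      (y := (skewMap a b c)^[n] (β, 0)) rfl] using hlim

theorem theorem4p3 :
    ∃ δ : ℝ, 0 < δ ∧ ∀ a b c : ℂ,
      0 < ‖a‖ → ‖a‖ < δ → 0 < ‖b‖ → ‖b‖ < δ → 0 < ‖c‖ → ‖c‖ < δ →
      ‖c‖ < δ * ‖a‖ → ‖b‖ < δ * ‖a‖ → ‖a * b‖ < δ * ‖c‖ →
      backwardOrbit (skewMap a b c) (0, 0) ⊆ immediateBasin (skewMap a b c) (0, 0) ∧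
      ∀ C : ℝ, 0 < C →
        ∃ z₀ : ℂ, (z₀, 0) ∈ immediateBasin (skewMap a b c) (0, 0) ∧
          ∀ q ∈ backwardOrbit (skewMap a b c) (0, 0),
            ENNReal.ofReal C ≤
              kobayashiDist (immediateBasin (skewMap a b c) (0, 0)) (z₀, 0) q := by
  refine ⟨1 / 1000, by norm_num, fun a b c ha0 ha hb0 hb _ hc hca hba hab => ?_⟩
  rw [Prod.mk_zero_zero, immediateBasin_skewMap ha hb hc]
  refine ⟨backwardOrbit_subset_basin a b c, fun C _ => ?_⟩
  obtain ⟨β, hβ, hβlim, hβorb⟩ := exists_boundary_point ha hb hc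
  -- Order of choices: `n` from `C`, `m` from `|b|`, `η` from `n + m`, and finally `z₀` from `C` and
  -- `η`.
  obtain ⟨n, hn⟩ := exists_pow_lt_of_lt_one
    (Real.exp_pos (-Real.exp (2 * C - Real.log (1 / 5)))) (by norm_num : (5 / 6 : ℝ) < 1)
  obtain ⟨m, hm⟩ := exists_pow_lt_of_lt_one hb0 (by norm_num : (17 / 20 : ℝ) < 1)
  have hβn : ‖β‖ ≤ 3 / 2 := by
    refine le_of_forall_pos_le_add fun ε hε => ?_
    obtain ⟨z, hz, hzβ⟩ := hβlim ε hε
    have h1 := norm_fst_lt_of_mem_basin ha hz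
    have h2 := norm_sub_le z (z - β)
    rw [sub_sub_cancel] at h2
    linarith
  have hnear : ∃ η > 0, ∀ z : ℂ, ‖z - β‖ < η →
      ∀ i < n + m, 1 / 4 < ‖((skewMap a b c)^[i] (z, 0)).1‖ := by
    have hev : ∀ᶠ z in 𝓝 β, ∀ i ∈ Finset.range (n + m),
        1 / 4 < ‖((skewMap a b c)^[i] (z, 0)).1‖ := by
      rw [Filter.eventually_all_finset]
      intro i _
      have hcont : Continuous fun z : ℂ => ‖((skewMap a b c)^[i] (z, 0)).1‖ :=
        (continuous_fst.comp (((continuous_skewMap a b c).iterate i).comp (by fun_prop))).norm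
      exact hcont.continuousAt.eventually_const_lt (lt_of_lt_of_le (by norm_num) (hβorb i))
    obtain ⟨η, hη, h⟩ := Metric.eventually_nhds_iff.mp hev
    exact ⟨η, hη, fun z hz i hi => h (by rwa [dist_eq_norm]) i (Finset.mem_range.mpr hi)⟩
  obtain ⟨η, hη, hnear⟩ := hnear
  obtain ⟨z₀, hz₀, hz₀β⟩ := hβlim _
    (Real.exp_pos (-Real.exp (2 * C - Real.log (η / 4))))
  refine ⟨z₀, hz₀, fun q hq => ?_⟩
  have hqb := backwardOrbit_subset_basin a b c hq
  obtain ⟨k, hk⟩ := mem_iUnion.mp hq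
  have hk : (skewMap a b c)^[k] q = 0 := hk
  rcases le_or_gt η ‖q.1 - β‖ with hfar | hclose
  · exact ofReal_le_kobayashiDist_of_fst ha hb hc hβ hβn hz₀ hqb hη hfar hz₀β.le
  · refine ofReal_le_kobayashiDist_of_snd ha hb hc hz₀ hqb hn.le fun j hj => ?_
    -- A small `w` at time `j < n` leaves `m` further steps with `|z| > 1/4`, because `j + m < n +
    -- m`.
    by_contra! hsmall
    refine iterate_ne_zero_of_norm_snd_le ha ha0 hb0 hc hca hba hab hm.le
      (u := (skewMap a b c)^[j] q) (fun i => ?_) ?_ hsmall.le k ?_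
    · exact norm_fst_lt_of_mem_basin ha
        ((mem_basin_iterate_iff i).mpr ((mem_basin_iterate_iff j).mpr hqb))
    · rw [← Function.iterate_add_apply, fst_skewMap_iterate_congr (x := q) (y := (q.1, 0)) rfl]
      exact (hnear q.1 hclose (m + j) (by omega)).le
    · rw [← Function.iterate_add_apply, add_comm, Function.iterate_add_apply, hk]
      exact Function.iterate_fixed (skewMap_zero a b c) j
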